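/- Let $\{|p\rangle,|q\rangle,|1\rangle,|2\rangle\}$ be an orthonormal basis of $\mathbb{C}^4_A$, and let $\{|p\rangle,|q\rangle,|1\rangle\}$ and $\{|p\rangle,|q\rangle,|2\rangle\}$ be orthonormal bases of $\mathbb{C}^3_B$ and $\mathbb{C}^3_C$, respectively. Put $|\epsilon_\pm\rangle=\frac{1}{\sqrt2}(|p\rangle\pm|q\rangle)$ and $|\gamma^i_\pm\rangle=\frac{1}{\sqrt2}(|q\rangle\pm|i\rangle)$ for $i\in\{1,2\}$, and let $\mathbb{G}_3\subset\mathbb{C}^4_A\otimes\mathbb{C}^3_B\otimes\mathbb{C}^3_C$ be the set of the fourteen states $$|\epsilon_\pm\rangle_A|1\rangle_B|2\rangle_C,\quad |1\rangle_A|\gamma^1_\pm\rangle_B|2\rangle_C,\quad |\gamma^1_\pm\rangle_A|p\rangle_B|2\rangle_C,\quad |p\rangle_A|\epsilon_\pm\rangle_B|2\rangle_C,$$ $$|2\rangle_A|1\rangle_B|\gamma^2_\pm\rangle_C,\quad |\gamma^2_\pm\rangle_A|1\rangle_B|p\rangle_C,\quad |p\rangle_A|1\rangle_B|\epsilon_\pm\rangle_C.$$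 Then $\mathbb{G}_3$ is a genuinely nonlocal set of product states (GNPS): its elements are pairwise orthogonal, normalized, fully product states, and for each bipartition of the three parties ($A|BC$, $B|AC$, $C|AB$) the states of $\mathbb{G}_3$, regarded as bipartite states shared by the two groups, cannot be perfectly discriminated by local operations and classical communication (LOCC). Here an LOCC protocol consists of a finite or infinite sequence of rounds; in each round one of the two groups performs a measurement (given by finitely or countably many Kraus operators, with arbitrary finite-dimensional output spaces) on its own system and announces the outcome, upon which the other group may apply a local isometry, and all choices may depend on all earlier outcomes. Perfect discrimination means that, for every state of the set, the probability that the state is correctly identified from the outcomes of the first $t$ rounds tends to $1$ as $t\to\infty$ (for a protocol with finitely many rounds: equals $1$ at the end). -/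

import Mathlib

open scoped ENNReal Topology Matrix

noncomputable section

namespace GNPS

/-! ### LOCC protocols for two parties

A pure state vector of the bipartite space `ℂ^α ⊗ ℂ^β` is written as its coefficient matrix
`ψ : Matrix α β ℂ`; the operator `A ⊗ B` then acts as `ψ ↦ A * ψ * Bᵀ`. -/

/-- A two-party LOCC protocol on `ℂ^α ⊗ ℂ^β`, with an unbounded number of rounds.
The public record of outcomes is a list of natural numbers, most recent outcome first. After the
record `h` the two laboratories hold systems of dimensions `dimA h` and `dimB h`. In each step one
of the two parties performs a measurement with (finitely or countably many) Kraus operators and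
announces the outcome; the other party, knowing the outcome, may apply a local isometry. Who
measures, and which operators are used, may depend on the whole record `h`.

A measurement with finitely many outcomes has zero Kraus operators for the other labels. A quantum
instrument whose outcomes have several Kraus operators each, or a local channel, is the special
case in which the later choices ignore a part of the record; local ancillas are covered since
dimensions may change, and shared randomness since Kraus operators may be multiples of the
identity. A protocol with finitely many rounds continues with trivial measurements. -/
structure Protocol (α β : Type) [Fintype α] [Fintype β] [DecidableEq α] [DecidableEq β] where
  dimA : List ℕ → ℕ
  dimB : List ℕ → ℕ
  /-- the isometric embeddings of the given systems into the laboratories -/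
  initA : Matrix (Fin (dimA [])) α ℂ
  initB : Matrix (Fin (dimB [])) β ℂ
  initA_isometry : initAᴴ * initA = 1
  initB_isometry : initBᴴ * initB = 1
  krausA : ∀ (h : List ℕ) (x : ℕ), Matrix (Fin (dimA (x :: h))) (Fin (dimA h)) ℂ
  krausB : ∀ (h : List ℕ) (x : ℕ), Matrix (Fin (dimB (x :: h))) (Fin (dimB h)) ℂ
  /-- either the first party measures and the second one applies isometries, or vice versa -/
  step : ∀ h : List ℕ,
    (HasSum (fun x => (krausA h x)ᴴ * krausA h x) 1 ∧
      ∀ x, (krausB h x)ᴴ * krausB h x = 1) ∨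
    (HasSum (fun x => (krausB h x)ᴴ * krausB h x) 1 ∧
      ∀ x, (krausA h x)ᴴ * krausA h x = 1)

namespace Protocol

variable {α β : Type} [Fintype α] [Fintype β] [DecidableEq α] [DecidableEq β]

open Classical in
/-- The probability that, starting after the record `h` with the (subnormalized) state `ψ`, the
record after `t` further steps lies in `E`. -/
def probFrom (P : Protocol α β) (E : Set (List ℕ)) :
    ∀ (_ : ℕ) (h : List ℕ), Matrix (Fin (P.dimA h)) (Fin (P.dimB h)) ℂ → ℝ≥0∞
  | 0, h, ψ => if h ∈ E then ∑ i, ∑ j, ‖ψ i j‖ₑ ^ 2 else 0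
  | t + 1, h, ψ =>
      ∑' x : ℕ, P.probFrom E t (x :: h) (P.krausA h x * ψ * (P.krausB h x)ᵀ)

/-- The probability that the record after `t` steps lies in `E` when the protocol is run on `ψ`. -/
def prob (P : Protocol α β) (E : Set (List ℕ)) (t : ℕ) (ψ : Matrix α β ℂ) : ℝ≥0∞ :=
  P.probFrom E t [] (P.initA * ψ * P.initBᵀ)

end Protocol

/-- The family of bipartite states `ψ` can be perfectly discriminated by LOCC: there are an LOCC
protocol and a rule `guess`, which reads a guess off the public record (`none`: undecided), such
that, whichever state `ψ i` is given, the probability that the guess after `t` steps is `i` tends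
to `1` as `t → ∞`. For a protocol that ends after finitely many rounds this says that the final
guess is correct with probability `1`. -/
def PerfectlyDiscriminable {α β : Type} [Fintype α] [Fintype β] [DecidableEq α] [DecidableEq β]
    {κ : Type*} (ψ : κ → Matrix α β ℂ) : Prop :=
  ∃ (P : Protocol α β) (guess : List ℕ → Option κ), ∀ i : κ,
    Filter.Tendsto (fun t => P.prob {h | guess h = some i} t (ψ i)) Filter.atTop (𝓝 1)

/-! ### Multipartite states -/

/-- The space `⨂ⱼ ℂ^(d j)` of `n` parties, in coordinates. -/
abbrev Space {n : ℕ} (d : Fin n → ℕ) : Type := EuclideanSpace ℂ (∀ j, Fin (d j))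

/-- The product vector `⨂ⱼ φ j`. -/
def tensor {n : ℕ} {d : Fin n → ℕ} (φ : ∀ j, EuclideanSpace ℂ (Fin (d j))) : Space d :=
  WithLp.toLp 2 fun x => ∏ j, φ j (x j)

/-- The state `ψ` viewed as a bipartite state for the cut `S | Sᶜ` of the set of parties. -/
def cut {n : ℕ} {d : Fin n → ℕ} (S : Finset (Fin n)) (ψ : Space d) :
    Matrix (∀ j : {j // j ∈ S}, Fin (d j)) (∀ j : {j // j ∉ S}, Fin (d j)) ℂ :=
  fun u v => ψ ((Equiv.piEquivPiSubtypeProd (· ∈ S) fun j => Fin (d j)).symm (u, v))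

/-- A genuinely nonlocal set of product states: pairwise orthogonal, normalized, fully product
states that cannot be perfectly discriminated by LOCC across any bipartition of the parties. -/
structure IsGNPS {n : ℕ} {d : Fin n → ℕ} (G : Set (Space d)) : Prop where
  orthonormal : Orthonormal ℂ (Subtype.val : G → Space d)
  product : ∀ ψ ∈ G, ∃ φ : ∀ j, EuclideanSpace ℂ (Fin (d j)), ψ = tensor φ
  nonlocal : ∀ S : Finset (Fin n), S.Nonempty → Sᶜ.Nonempty →
    ¬ PerfectlyDiscriminable (fun ψ : G => cut S (ψ : Space d))

/-! ### The set `𝔾₃` -/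

/-- `|a⟩ ⊗ |b⟩ ⊗ |c⟩` in `ℂ⁴ ⊗ ℂ³ ⊗ ℂ³`. -/
def tri (a : EuclideanSpace ℂ (Fin 4)) (b c : EuclideanSpace ℂ (Fin 3)) : Space ![4, 3, 3] :=
  tensor fun j => match j with
    | 0 => a
    | 1 => b
    | 2 => c

/-- `(u + s v) / √2`, for a sign `s`. -/
def pm {m : ℕ} (s : ℂ) (u v : EuclideanSpace ℂ (Fin m)) : EuclideanSpace ℂ (Fin m) :=
  ((1 / √2 : ℝ) : ℂ) • (u + s • v)

/-- The fourteen states of `𝔾₃`; the kets `|p⟩, |q⟩, |1⟩, |2⟩` of the first party are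
`pA, qA, oneA, twoA`, and similarly for the second (`|p⟩, |q⟩, |1⟩`) and the third party
(`|p⟩, |q⟩, |2⟩`). -/
def G3 (pA qA oneA twoA : EuclideanSpace ℂ (Fin 4)) (pB qB oneB : EuclideanSpace ℂ (Fin 3))
    (pC qC twoC : EuclideanSpace ℂ (Fin 3)) : Set (Space ![4, 3, 3]) :=
  ⋃ s ∈ ({1, -1} : Set ℂ),
    {tri (pm s pA qA) oneB twoC,
      tri oneA (pm s qB oneB) twoC,
      tri (pm s qA oneA) pB twoC,
      tri pA (pm s pB qB) twoC,
      tri twoA oneB (pm s qC twoC),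
      tri (pm s qA twoA) oneB pC,
      tri pA oneB (pm s pC qC)}

end GNPS

end

/-! Every bipartition separates A from B or A from C. The states with third factor `twoC` are eight
domino states of A and B, built on p, q, 1; those with second factor `oneB` are eight domino states
of A and C, with the two states ε± ⊗ 1 ⊗ 2 in common. Hence it suffices that the domino states of ℂ³
⊗ ℂ³, embedded by local isometries, cannot be discriminated across the cut.

Orthogonality-preserving local measurements on domino states are trivial; infinite protocols require
a quantitative form of this. After any record the states have been processed by some A ⊗ B, with
effects a = AᴴA and b = BᴴB. If one effect is nearly scalar (`Balanced`) and all overlaps of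
distinct processed states are below tr a · tr b / 120, the other effect is nearly scalar with the
same tolerance (`Balanced.left_of_overlap`, `Balanced.right_of_overlap`), so nothing deteriorates
with the number of rounds.

The quantity `loss` adds K times the error probabilities and K⁻¹ times the total probabilities. Like
inner products and tr a · tr b, it is additive over outcomes. It dominates every overlap
(`overlap_le_loss`), because a record is wrong for at least one of two states. By induction on the
remaining rounds it dominates tr a · tr b / 120 from a balanced node (`trace_le_loss_of_balanced`):
a branch either stays balanced or has an overlap of that size. At the root this gives 9/120, whereas
vanishing errors would make the loss tend to 16/K. -/

noncomputable section

namespace GNPS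

open Matrix

/-! ### Conservation of probability -/

namespace Protocol

variable {α β : Type} [Fintype α] [Fintype β] [DecidableEq α] [DecidableEq β]

/-- A bilinear function of the two effects is additive over the outcomes of a step. -/
theorem hasSum_step (P : Protocol α β) (h : List ℕ)
    (Φ : Matrix (Fin (P.dimA h)) (Fin (P.dimA h)) ℂ →ₗ[ℂ]
      Matrix (Fin (P.dimB h)) (Fin (P.dimB h)) ℂ →ₗ[ℂ] ℂ) :
    HasSum (fun x => Φ ((P.krausA h x)ᴴ * P.krausA h x) ((P.krausB h x)ᴴ * P.krausB h x))
      (Φ 1 1) := by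
  rcases P.step h with ⟨hs, hi⟩ | ⟨hs, hi⟩
  · simp only [hi]
    exact hs.map (Φ.flip 1) (Φ.flip 1).continuous_of_finiteDimensional
  · simp only [hi]
    exact hs.map (Φ 1) (Φ 1).continuous_of_finiteDimensional

end Protocol

/-- The squared norm of a bipartite vector. -/
def normSq {m n : Type*} [Fintype m] [Fintype n] (ψ : Matrix m n ℂ) : ℝ≥0∞ :=
  ∑ i, ∑ j, ‖ψ i j‖ₑ ^ 2

theorem normSq_smul {m n : Type*} [Fintype m] [Fintype n] (c : ℂ) (ψ : Matrix m n ℂ) :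
    normSq (c • ψ) = ‖c‖ₑ ^ 2 * normSq ψ := by
  simp [normSq, Finset.mul_sum, enorm_mul, mul_pow]

theorem trace_conjTranspose_mul_self {m n : Type*} [Fintype m] [Fintype n] (ψ : Matrix m n ℂ) :
    (ψᴴ * ψ).trace = ((∑ i, ∑ j, ‖ψ i j‖ ^ 2 : ℝ) : ℂ) := by
  rw [Finset.sum_comm]
  simp [Matrix.trace, Matrix.mul_apply, RCLike.conj_mul]

theorem normSq_eq_ofReal {m n : Type*} [Fintype m] [Fintype n] (ψ : Matrix m n ℂ) :
    normSq ψ = ENNReal.ofReal (ψᴴ * ψ).trace.re := by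
  rw [trace_conjTranspose_mul_self, Complex.ofReal_re,
    ENNReal.ofReal_sum_of_nonneg fun i _ => by positivity]
  refine Finset.sum_congr rfl fun i _ => ?_
  rw [ENNReal.ofReal_sum_of_nonneg fun i _ => by positivity]
  refine Finset.sum_congr rfl fun j _ => ?_
  rw [ENNReal.ofReal_pow (norm_nonneg _), ofReal_norm]

theorem trace_conjTranspose_mul_sandwich {m n m' n' : Type*} [Fintype m] [Fintype n] [Fintype m']
    [Fintype n'] (K : Matrix m' m ℂ) (L : Matrix n' n ℂ) (ψ φ : Matrix m n ℂ) :
    ((K * ψ * Lᵀ)ᴴ * (K * φ * Lᵀ)).trace = (ψᴴ * (Kᴴ * K) * φ * (Lᴴ * L)ᵀ).trace := by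
  simp only [conjTranspose_mul, transpose_mul, Matrix.mul_assoc]
  rw [Matrix.trace_mul_comm]
  simp only [Matrix.mul_assoc]
  rfl

namespace Protocol

variable {α β : Type} [Fintype α] [Fintype β] [DecidableEq α] [DecidableEq β]

/-- Inner products, not just norms, are conserved on summing over outcomes; this lets overlaps be
tracked along the tree of records. -/
theorem hasSum_trace (P : Protocol α β) (h : List ℕ)
    (ψ φ : Matrix (Fin (P.dimA h)) (Fin (P.dimB h)) ℂ) :
    HasSum (fun x => ((P.krausA h x * ψ * (P.krausB h x)ᵀ)ᴴ *
      (P.krausA h x * φ * (P.krausB h x)ᵀ)).trace) (ψᴴ * φ).trace := by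
  have := P.hasSum_step h (LinearMap.mk₂ ℂ (fun M N => (ψᴴ * M * φ * Nᵀ).trace)
    (fun M M' N => by simp [Matrix.mul_add, Matrix.add_mul])
    (fun c M N => by simp)
    (fun M N N' => by simp [Matrix.mul_add])
    (fun c M N => by simp))
  simp only [LinearMap.mk₂_apply, transpose_one, Matrix.mul_one] at this
  simpa only [trace_conjTranspose_mul_sandwich] using this

theorem tsum_normSq (P : Protocol α β) (h : List ℕ)
    (ψ : Matrix (Fin (P.dimA h)) (Fin (P.dimB h)) ℂ) :
    ∑' x, normSq (P.krausA h x * ψ * (P.krausB h x)ᵀ) = normSq ψ := by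
  simp only [normSq_eq_ofReal]
  have hs := Complex.hasSum_re (P.hasSum_trace h ψ ψ)
  rw [← hs.tsum_eq, ENNReal.ofReal_tsum_of_nonneg _ hs.summable]
  intro x
  rw [trace_conjTranspose_mul_self, Complex.ofReal_re]
  positivity

theorem probFrom_univ (P : Protocol α β) (t : ℕ) : ∀ (h : List ℕ)
    (ψ : Matrix (Fin (P.dimA h)) (Fin (P.dimB h)) ℂ),
    P.probFrom Set.univ t h ψ = normSq ψ := by
  induction t with
  | zero => intro h ψ; simp [probFrom, normSq]
  | succ t ih => intro h ψ; simp only [probFrom, ih, tsum_normSq]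

theorem probFrom_add_compl (P : Protocol α β) (E : Set (List ℕ)) (t : ℕ) : ∀ (h : List ℕ)
    (ψ : Matrix (Fin (P.dimA h)) (Fin (P.dimB h)) ℂ),
    P.probFrom E t h ψ + P.probFrom Eᶜ t h ψ = normSq ψ := by
  induction t with
  | zero =>
    intro h ψ
    by_cases hE : h ∈ E <;> simp [probFrom, normSq, hE]
  | succ t ih =>
    intro h ψ
    simp only [probFrom]
    rw [← ENNReal.tsum_add]
    simp only [ih, tsum_normSq]

theorem probFrom_smul (P : Protocol α β) (E : Set (List ℕ)) (c : ℂ) (t : ℕ) : ∀ (h : List ℕ)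
    (ψ : Matrix (Fin (P.dimA h)) (Fin (P.dimB h)) ℂ),
    P.probFrom E t h (c • ψ) = ‖c‖ₑ ^ 2 * P.probFrom E t h ψ := by
  induction t with
  | zero =>
    intro h ψ
    by_cases hE : h ∈ E <;> simp only [probFrom, hE, if_true, if_false, mul_zero]
    exact normSq_smul c ψ
  | succ t ih =>
    intro h ψ
    simp only [probFrom, Matrix.mul_smul, Matrix.smul_mul, ih, ENNReal.tsum_mul_left]

end Protocol

/-! ### The domino states -/

/-- The sign `±1` encoded by a Boolean. -/
def sgn (s : Bool) : ℂ := if s then 1 else -1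

/-- The first tensor factors of the (unnormalized) domino states. -/
def dominoL (i : Fin 4 × Bool) : Fin 3 → ℂ :=
  ![![1, sgn i.2, 0], ![0, 0, 1], ![0, 1, sgn i.2], ![1, 0, 0]] i.1

/-- The second tensor factors of the (unnormalized) domino states. -/
def dominoR (i : Fin 4 × Bool) : Fin 3 → ℂ :=
  ![![0, 0, 1], ![0, 1, sgn i.2], ![1, 0, 0], ![1, sgn i.2, 0]] i.1

/-- The eight unnormalized domino states of `ℂ³ ⊗ ℂ³`. -/
def domino (i : Fin 4 × Bool) : Matrix (Fin 3) (Fin 3) ℂ := vecMulVec (dominoL i) (dominoR i)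

theorem trace_conjTranspose_mul_vecMulVec {k l m n : Type*} [Fintype k] [Fintype l]
    [Fintype m] [Fintype n] (A : Matrix m k ℂ) (B : Matrix n l ℂ) (x x' : k → ℂ) (y y' : l → ℂ) :
    ((A * vecMulVec x y * Bᵀ)ᴴ * (A * vecMulVec x' y' * Bᵀ)).trace =
      (star x ⬝ᵥ (Aᴴ * A) *ᵥ x') * (star y ⬝ᵥ (Bᴴ * B) *ᵥ y') := by
  rw [trace_conjTranspose_mul_sandwich, conjTranspose_vecMulVec,
    Matrix.mul_assoc _ _ (vecMulVec x' y'), mul_vecMulVec, vecMulVec_mul_vecMulVec, vecMulVec_mul,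
    trace_vecMulVec, vecMul_transpose, dotProduct_comm, mulVec_smul, smul_dotProduct, smul_eq_mul,
    dotProduct_comm ((Bᴴ * B) *ᵥ y')]

/-- A positive operator is nearly a multiple of the identity. -/
def Balanced (a : Matrix (Fin 3) (Fin 3) ℂ) : Prop :=
  (∀ i j, i ≠ j → ‖a i j‖ ≤ ‖a.trace‖ / 10) ∧ ∀ i j, ‖a i i - a j j‖ ≤ ‖a.trace‖ / 10
open scoped ComplexOrder

/-! ### Stability of nearly scalar effects -/

theorem exists_real_diag {a : Matrix (Fin 3) (Fin 3) ℂ} (ha : a.PosSemidef) :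
    ∃ r : Fin 3 → ℝ, (∀ i, 0 ≤ r i) ∧ (∀ i, a i i = r i) ∧ ‖a.trace‖ = r 0 + r 1 + r 2 := by
  have h0 : ∀ i, 0 ≤ a i i := fun i => ha.diag_nonneg
  have h1 : ∀ i, a i i = ((a i i).re : ℂ) := fun i =>
    (Complex.ext rfl (by simpa using (Complex.le_def.1 (h0 i)).2.symm))
  have h2 : ∀ i, 0 ≤ (a i i).re := fun i => by simpa using (Complex.le_def.1 (h0 i)).1
  refine ⟨fun i => (a i i).re, h2, h1, ?_⟩
  rw [Matrix.trace_fin_three, h1 0, h1 1, h1 2, ← Complex.ofReal_add, ← Complex.ofReal_add,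
    Complex.norm_of_nonneg (by linarith [h2 0, h2 1, h2 2])]

/-- For Hermitian `a` the two off-diagonal terms add up to an imaginary number, so the real part is
the difference of the diagonal entries. -/
theorem norm_diag_sub_le {a : Matrix (Fin 3) (Fin 3) ℂ} (ha : a.PosSemidef) (i j : Fin 3) :
    ‖a i i - a j j‖ ≤ ‖a i i - a i j + a j i - a j j‖ := by
  obtain ⟨r, -, hr, -⟩ := exists_real_diag ha
  have hji : a j i = star (a i j) := (ha.1.apply j i).symm
  rw [hji, hr i, hr j]
  have hre : (((r i : ℂ) - a i j + star (a i j) - r j).re) = r i - r j := by simp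
  rw [← Complex.ofReal_sub, Complex.norm_real, Real.norm_eq_abs, ← hre]
  exact Complex.abs_re_le_norm _

theorem norm_le_of_add_sub {z w : ℂ} {m : ℝ} (h₁ : ‖z + w‖ ≤ m) (h₂ : ‖z - w‖ ≤ m) :
    ‖z‖ ≤ m ∧ ‖w‖ ≤ m := by
  have e₁ : z = (1 / 2 : ℂ) * ((z + w) + (z - w)) := by ring
  have e₂ : w = (1 / 2 : ℂ) * ((z + w) - (z - w)) := by ring
  have n : ‖(1 / 2 : ℂ)‖ = 1 / 2 := by norm_num
  constructor
  · rw [e₁, norm_mul, n]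
    linarith [norm_add_le (z + w) (z - w)]
  · rw [e₂, norm_mul, n]
    linarith [norm_sub_le (z + w) (z - w)]

/-- The diagonal entries 0 and 2 are compared through entry 1, which costs `2 * m`; hence 1/20 is
half the tolerance 1/10 of `Balanced`. The off-diagonal entries not bounded directly follow by
Hermitian symmetry. -/
theorem balanced_of_norm_le {a : Matrix (Fin 3) (Fin 3) ℂ} (ha : a.PosSemidef) {m : ℝ}
    (hm : m ≤ ‖a.trace‖ / 20)
    (h₀₁ : ‖a 0 0 - a 0 1 + a 1 0 - a 1 1‖ ≤ m) (h₁₂ : ‖a 1 1 - a 1 2 + a 2 1 - a 2 2‖ ≤ m)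
    (h₂ : ‖a 2 0 + a 2 1‖ ≤ m) (h₂' : ‖a 2 0 - a 2 1‖ ≤ m)
    (h₀ : ‖a 0 1 + a 0 2‖ ≤ m) (h₀' : ‖a 0 1 - a 0 2‖ ≤ m) : Balanced a := by
  have d₁ := (norm_diag_sub_le ha 0 1).trans h₀₁
  have d₂ := (norm_diag_sub_le ha 1 2).trans h₁₂
  have d₃ : ‖a 0 0 - a 2 2‖ ≤ m + m := by
    rw [← sub_add_sub_cancel _ (a 1 1)]
    exact (norm_add_le _ _).trans (add_le_add d₁ d₂)
  have hsymm : ∀ i j, ‖a i j‖ = ‖a j i‖ := fun i j => by rw [← ha.1.apply i j, norm_star]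
  obtain ⟨e₂₀, e₂₁⟩ := norm_le_of_add_sub h₂ h₂'
  obtain ⟨e₀₁, e₀₂⟩ := norm_le_of_add_sub h₀ h₀'
  have hm0 : 0 ≤ m := (norm_nonneg _).trans e₂₀
  have e₁₀ := hsymm 1 0
  have e₁₂ := hsymm 1 2
  have d₁' := norm_sub_rev (a 1 1) (a 0 0)
  have d₂' := norm_sub_rev (a 2 2) (a 1 1)
  have d₃' := norm_sub_rev (a 2 2) (a 0 0)
  constructor
  · intro i j hij
    fin_cases i <;> fin_cases j <;> simp at hij ⊢ <;> linarith
  · intro i j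
    fin_cases i <;> fin_cases j <;> simp <;> linarith

namespace Balanced

variable {a b : Matrix (Fin 3) (Fin 3) ℂ}

/-- The trace is at most three times any diagonal entry plus two deviations of a tenth of the trace,
and (1 - 2/10) / 3 = 4/15. -/
theorem le_norm_diag (ha : a.PosSemidef) (h : Balanced a) (i : Fin 3) :
    ‖a.trace‖ * (4 / 15) ≤ ‖a i i‖ := by
  obtain ⟨r, h0, hr, ht⟩ := exists_real_diag ha
  have hd : ∀ i j, |r i - r j| ≤ ‖a.trace‖ / 10 := fun i j => by
    have := h.2 i j
    rwa [hr i, hr j, ← Complex.ofReal_sub, Complex.norm_real] at this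
  rw [hr i, Complex.norm_of_nonneg (h0 i)]
  have h1 := fun i j => abs_le.1 (hd i j)
  fin_cases i <;> simp <;>
    linarith [(h1 0 1).1, (h1 0 1).2, (h1 0 2).1, (h1 0 2).2, (h1 1 2).1, (h1 1 2).2]

/-- The constant is 4/15 - 1/10 = 1/6. -/
theorem le_norm_diag_add (ha : a.PosSemidef) (h : Balanced a) (i : Fin 3) {z : ℂ}
    (hz : ‖z‖ ≤ ‖a.trace‖ / 10) : ‖a.trace‖ / 6 ≤ ‖a i i + z‖ := by
  have h1 := norm_sub_le (a i i + z) z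
  rw [add_sub_cancel_right] at h1
  linarith [le_norm_diag ha h i]

end Balanced

/-- The inner products of the domino states after the local effects `a` and `b`. -/
def overlap (a b : Matrix (Fin 3) (Fin 3) ℂ) (i j : Fin 4 × Bool) : ℂ :=
  (star (dominoL i) ⬝ᵥ a *ᵥ dominoL j) * (star (dominoR i) ⬝ᵥ b *ᵥ dominoR j)

theorem overlap_one_eq_zero {i j : Fin 4 × Bool} (hij : i ≠ j) : overlap 1 1 i j = 0 := by
  obtain ⟨k, s⟩ := i
  obtain ⟨l, s'⟩ := j
  fin_cases k <;> fin_cases l <;> cases s <;> cases s' <;>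
    simp [overlap, dominoL, dominoR, sgn, dotProduct, Fin.sum_univ_three] at hij ⊢

theorem overlap_one_self (i : Fin 4 × Bool) : overlap 1 1 i i = 2 := by
  obtain ⟨k, s⟩ := i
  fin_cases k <;> cases s <;>
    simp [overlap, dominoL, dominoR, sgn, dotProduct, Fin.sum_univ_three] <;> norm_num

theorem norm_le_of_mul_lt {z w : ℂ} {x y : ℝ} (hy : 0 < y) (hw : y / 6 ≤ ‖w‖)
    (h : ‖z * w‖ < x * y / 120) : ‖z‖ ≤ x / 20 := by
  rw [norm_mul] at h
  by_contra! hc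
  nlinarith [mul_le_mul_of_nonneg_left hw (norm_nonneg z), mul_lt_mul_of_pos_right hc hy]

/-- Each chosen overlap is a product of a combination of entries of `a` and a factor from `b` of
size at least a sixth of its trace. Dividing turns 1/120 into 1/20, as `balanced_of_norm_le`
requires. -/
theorem Balanced.left_of_overlap {a b : Matrix (Fin 3) (Fin 3) ℂ} (ha : a.PosSemidef)
    (hb : b.PosSemidef) (h : Balanced b)
    (ho : ∀ i j, i ≠ j → ‖overlap a b i j‖ < ‖a.trace‖ * ‖b.trace‖ / 120) : Balanced a := by
  -- A zero trace would contradict the strict inequality in `ho`.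
  have hpos : 0 < ‖b.trace‖ := by
    refine lt_of_le_of_ne (norm_nonneg _) fun h0 => ?_
    have := ho (0, true) (0, false) (by simp)
    rw [← h0] at this
    linarith [norm_nonneg (overlap a b (0, true) (0, false))]
  have hz : ‖(0 : ℂ)‖ ≤ ‖b.trace‖ / 10 := by rw [norm_zero]; positivity
  have key : ∀ (i j : Fin 4 × Bool) (k : Fin 3) (z w : ℂ), i ≠ j → ‖z‖ ≤ ‖b.trace‖ / 10 →
      overlap a b i j = w * (b k k + z) → ‖w‖ ≤ ‖a.trace‖ / 20 := fun i j k z w hij hz hw =>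
    norm_le_of_mul_lt hpos (h.le_norm_diag_add hb k hz) (hw ▸ ho i j hij)
  -- The two signs of one tile give diagonal differences; neighbouring tiles with both signs give
  -- sums and differences of off-diagonal entries.
  refine balanced_of_norm_le ha le_rfl
    (key (0, true) (0, false) 2 0 _ (by simp) hz ?_)
    (key (2, true) (2, false) 0 0 _ (by simp) hz ?_)
    (key (1, true) (0, true) 2 _ _ (by simp) (h.1 1 2 (by decide)) ?_)
    (key (1, true) (0, false) 2 _ _ (by simp) (h.1 1 2 (by decide)) ?_)
    (key (3, true) (2, true) 0 _ _ (by simp) (h.1 1 0 (by decide)) ?_)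
    (key (3, true) (2, false) 0 _ _ (by simp) (h.1 1 0 (by decide)) ?_)
  all_goals
    simp [overlap, dominoL, dominoR, sgn, dotProduct, mulVec, Fin.sum_univ_three,
      -mul_eq_mul_right_iff, -mul_eq_mul_left_iff]
    try ring

theorem Balanced.right_of_overlap {a b : Matrix (Fin 3) (Fin 3) ℂ} (ha : a.PosSemidef)
    (hb : b.PosSemidef) (h : Balanced a)
    (ho : ∀ i j, i ≠ j → ‖overlap a b i j‖ < ‖a.trace‖ * ‖b.trace‖ / 120) : Balanced b := by
  have hpos : 0 < ‖a.trace‖ := by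
    refine lt_of_le_of_ne (norm_nonneg _) fun h0 => ?_
    have := ho (0, true) (0, false) (by simp)
    rw [← h0] at this
    linarith [norm_nonneg (overlap a b (0, true) (0, false))]
  have hz : ‖(0 : ℂ)‖ ≤ ‖a.trace‖ / 10 := by rw [norm_zero]; positivity
  have key : ∀ (i j : Fin 4 × Bool) (k : Fin 3) (z w : ℂ), i ≠ j → ‖z‖ ≤ ‖a.trace‖ / 10 →
      overlap a b i j = w * (a k k + z) → ‖w‖ ≤ ‖b.trace‖ / 20 := fun i j k z w hij hz hw =>
    norm_le_of_mul_lt hpos (h.le_norm_diag_add ha k hz)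
      (by rw [← hw, mul_comm ‖b.trace‖]; exact ho i j hij)
  refine balanced_of_norm_le hb le_rfl
    (key (3, true) (3, false) 0 0 _ (by simp) hz ?_)
    (key (1, true) (1, false) 2 0 _ (by simp) hz ?_)
    (key (0, true) (3, true) 0 _ _ (by simp) (h.1 1 0 (by decide)) ?_)
    (key (0, true) (3, false) 0 _ _ (by simp) (h.1 1 0 (by decide)) ?_)
    (key (2, true) (1, true) 2 _ _ (by simp) (h.1 1 2 (by decide)) ?_)
    (key (2, true) (1, false) 2 _ _ (by simp) (h.1 1 2 (by decide)) ?_)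
  all_goals
    simp [overlap, dominoL, dominoR, sgn, dotProduct, mulVec, Fin.sum_univ_three,
      -mul_eq_mul_right_iff, -mul_eq_mul_left_iff]
    try ring

/-- The first factor is at least 2 · 4/15 - 2/10 = 1/3 of its trace and the second at least 4/15,
far above 1/120. -/
theorem Balanced.le_norm_overlap_self {a b : Matrix (Fin 3) (Fin 3) ℂ} (ha : a.PosSemidef)
    (hb : b.PosSemidef) (h : Balanced a) (h' : Balanced b) (s : Bool) :
    ‖a.trace‖ * ‖b.trace‖ / 120 ≤ ‖overlap a b (0, s) (0, s)‖ := by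
  have hs : ‖sgn s‖ = 1 := by cases s <;> simp [sgn]
  have e : overlap a b (0, s) (0, s) =
      (a 0 0 + a 1 1 + (sgn s * a 0 1 + sgn s * a 1 0)) * b 2 2 := by
    cases s <;> simp [overlap, dominoL, dominoR, sgn, dotProduct, mulVec, Fin.sum_univ_three,
      -mul_eq_mul_right_iff] <;> ring
  have hsum : ‖a 0 0 + a 1 1‖ = ‖a 0 0‖ + ‖a 1 1‖ := by
    obtain ⟨r, h0, hr, -⟩ := exists_real_diag ha
    rw [hr 0, hr 1, ← Complex.ofReal_add, Complex.norm_of_nonneg (h0 0),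
      Complex.norm_of_nonneg (h0 1), Complex.norm_of_nonneg (add_nonneg (h0 0) (h0 1))]
  have hoff : ‖sgn s * a 0 1 + sgn s * a 1 0‖ ≤ ‖a.trace‖ / 10 + ‖a.trace‖ / 10 := by
    refine (norm_add_le _ _).trans ?_
    rw [norm_mul, norm_mul, hs, one_mul, one_mul]
    exact add_le_add (h.1 0 1 (by decide)) (h.1 1 0 (by decide))
  have h1 := norm_sub_le (a 0 0 + a 1 1 + (sgn s * a 0 1 + sgn s * a 1 0))
    (sgn s * a 0 1 + sgn s * a 1 0)
  rw [add_sub_cancel_right] at h1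
  rw [e, norm_mul]
  have h2 : ‖a.trace‖ / 3 ≤ ‖a 0 0 + a 1 1 + (sgn s * a 0 1 + sgn s * a 1 0)‖ := by
    linarith [h.le_norm_diag ha 0, h.le_norm_diag ha 1]
  refine le_trans ?_ (mul_le_mul h2 (h'.le_norm_diag hb 2) (by positivity) (norm_nonneg _))
  have := mul_nonneg (norm_nonneg a.trace) (norm_nonneg b.trace)
  linarith

/-! ### The domino states cannot be discriminated -/

theorem enorm_mul_le_young (x y : ℂ) {K : NNReal} (hK : K ≠ 0) :
    ‖x‖ₑ * ‖y‖ₑ ≤ K * ‖x‖ₑ ^ 2 + (K : ℝ≥0∞)⁻¹ * ‖y‖ₑ ^ 2 := by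
  rw [← ENNReal.coe_inv hK]
  simp only [enorm_eq_nnnorm]
  norm_cast
  rw [← NNReal.coe_le_coe]
  push_cast
  have hK' : (0 : ℝ) < K := by positivity
  rw [← sub_nonneg]
  have : (K : ℝ) * ‖x‖ ^ 2 + (K : ℝ)⁻¹ * ‖y‖ ^ 2 - ‖x‖ * ‖y‖ =
      (K : ℝ)⁻¹ * ((K * ‖x‖ - ‖y‖ / 2) ^ 2 + 3 / 4 * ‖y‖ ^ 2) := by
    field_simp; ring
  rw [this]
  positivity

theorem enorm_trace_le {m n : Type*} [Fintype m] [Fintype n] (ψ φ : Matrix m n ℂ) :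
    ‖(ψᴴ * φ).trace‖ₑ ≤ ∑ i, ∑ j, ‖ψ i j‖ₑ * ‖φ i j‖ₑ := by
  rw [Finset.sum_comm]
  simp only [Matrix.trace, Matrix.mul_apply, Matrix.diag_apply, conjTranspose_apply]
  refine (enorm_sum_le _ _).trans (Finset.sum_le_sum fun j _ => ?_)
  refine (enorm_sum_le _ _).trans (Finset.sum_le_sum fun i _ => ?_)
  rw [enorm_mul]
  simp [enorm_eq_nnnorm]

/-- The asymmetric weights let the wrongly guessed state pay the large weight `K` and the other one
only `K⁻¹`. -/
theorem enorm_trace_le_young {m n : Type*} [Fintype m] [Fintype n] (ψ φ : Matrix m n ℂ)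
    {K : NNReal} (hK : K ≠ 0) :
    ‖(ψᴴ * φ).trace‖ₑ ≤ K * normSq ψ + (K : ℝ≥0∞)⁻¹ * normSq φ := by
  refine (enorm_trace_le ψ φ).trans ?_
  simp only [normSq, Finset.mul_sum, ← Finset.sum_add_distrib]
  exact Finset.sum_le_sum fun i _ => Finset.sum_le_sum fun j _ => enorm_mul_le_young _ _ hK

namespace Protocol

variable {α β : Type} [Fintype α] [Fintype β] [DecidableEq α] [DecidableEq β]

/-- A weighted sum of the error probabilities and the total probabilities over the domino states
that have been processed by the local operators `A` and `B`. -/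
def loss (P : Protocol α β) (E : Fin 4 × Bool → Set (List ℕ)) (K : NNReal) (t : ℕ) (h : List ℕ)
    (A : Matrix (Fin (P.dimA h)) (Fin 3) ℂ) (B : Matrix (Fin (P.dimB h)) (Fin 3) ℂ) : ℝ≥0∞ :=
  ∑ i, (K * P.probFrom (E i)ᶜ t h (A * domino i * Bᵀ) +
    (K : ℝ≥0∞)⁻¹ * P.probFrom Set.univ t h (A * domino i * Bᵀ))

variable (P : Protocol α β) (E : Fin 4 × Bool → Set (List ℕ)) (K : NNReal)

theorem loss_succ (t : ℕ) (h : List ℕ)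
    (A : Matrix (Fin (P.dimA h)) (Fin 3) ℂ) (B : Matrix (Fin (P.dimB h)) (Fin 3) ℂ) :
    P.loss E K (t + 1) h A B =
      ∑' x, P.loss E K t (x :: h) (P.krausA h x * A) (P.krausB h x * B) := by
  simp only [loss, probFrom, ← ENNReal.tsum_mul_left, ← ENNReal.tsum_add]
  rw [Summable.tsum_finsetSum fun _ _ => ENNReal.summable]
  simp only [transpose_mul, Matrix.mul_assoc]

theorem term_le_loss (t : ℕ) (h : List ℕ)
    (A : Matrix (Fin (P.dimA h)) (Fin 3) ℂ) (B : Matrix (Fin (P.dimB h)) (Fin 3) ℂ)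
    (i : Fin 4 × Bool) :
    K * P.probFrom (E i)ᶜ t h (A * domino i * Bᵀ) +
      (K : ℝ≥0∞)⁻¹ * P.probFrom Set.univ t h (A * domino i * Bᵀ) ≤ P.loss E K t h A B :=
  Finset.single_le_sum (f := fun i => K * P.probFrom (E i)ᶜ t h (A * domino i * Bᵀ) +
    (K : ℝ≥0∞)⁻¹ * P.probFrom Set.univ t h (A * domino i * Bᵀ)) (fun _ _ => zero_le)
    (Finset.mem_univ i)

theorem probFrom_zero_of_mem {F : Set (List ℕ)} {h : List ℕ} (hF : h ∈ F)
    (ψ : Matrix (Fin (P.dimA h)) (Fin (P.dimB h)) ℂ) : P.probFrom F 0 h ψ = normSq ψ := by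
  simp [probFrom, hF, normSq]

theorem trace_eq_overlap {m n : Type*} [Fintype m] [Fintype n] (A : Matrix m (Fin 3) ℂ)
    (B : Matrix n (Fin 3) ℂ) (i j : Fin 4 × Bool) :
    ((A * domino i * Bᵀ)ᴴ * (A * domino j * Bᵀ)).trace = overlap (Aᴴ * A) (Bᴴ * B) i j :=
  trace_conjTranspose_mul_vecMulVec A B _ _ _ _

variable {E K}

/-- At a leaf the disjoint guess sets make the record an error for `i` or for `j`, and Young's
inequality applies with that state first. Additivity over outcomes and the triangle inequality carry
the bound up the tree. -/
theorem overlap_le_loss (hE : Pairwise (Function.onFun Disjoint E)) (hK : K ≠ 0)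
    {i j : Fin 4 × Bool} (hij : i ≠ j) (t : ℕ) : ∀ (h : List ℕ)
    (A : Matrix (Fin (P.dimA h)) (Fin 3) ℂ) (B : Matrix (Fin (P.dimB h)) (Fin 3) ℂ),
    ‖((A * domino i * Bᵀ)ᴴ * (A * domino j * Bᵀ)).trace‖ₑ ≤ P.loss E K t h A B := by
  induction t with
  | zero =>
    intro h A B
    have main : ∀ k l, k ≠ l → h ∉ E k →
        ‖((A * domino k * Bᵀ)ᴴ * (A * domino l * Bᵀ)).trace‖ₑ ≤ P.loss E K 0 h A B := by
      intro k l hkl hk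
      refine (enorm_trace_le_young _ _ hK).trans ?_
      -- Only the error term of `k` and the total term of `l` are kept.
      rw [loss, ← Finset.add_sum_erase _ _ (Finset.mem_univ k),
        ← Finset.add_sum_erase _ _ (Finset.mem_erase.2 ⟨hkl.symm, Finset.mem_univ l⟩)]
      rw [P.probFrom_zero_of_mem (F := (E k)ᶜ) hk, probFrom_univ, probFrom_univ]
      refine add_le_add le_self_add (le_trans le_add_self le_self_add)
    by_cases hi : h ∈ E i
    · have hj : h ∉ E j := fun hj => Set.disjoint_left.1 (hE hij) hi hj
      rw [enorm_eq_nnnorm, ← nnnorm_star, ← enorm_eq_nnnorm, ← Matrix.trace_conjTranspose, conjTranspose_mul,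
        conjTranspose_conjTranspose]
      exact main j i hij.symm hj
    · exact main i j hij hi
  | succ t ih =>
    intro h A B
    rw [← (P.hasSum_trace h _ _).tsum_eq, loss_succ]
    refine enorm_tsum_le_tsum_enorm.trans (ENNReal.tsum_le_tsum fun x => ?_)
    convert ih (x :: h) (P.krausA h x * A) (P.krausB h x * B) using 4 <;>
      simp only [transpose_mul, Matrix.mul_assoc]

theorem hasSum_trace_gram (h : List ℕ)
    (A : Matrix (Fin (P.dimA h)) (Fin 3) ℂ) (B : Matrix (Fin (P.dimB h)) (Fin 3) ℂ) :
    HasSum (fun x => ((P.krausA h x * A)ᴴ * (P.krausA h x * A)).trace *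
      ((P.krausB h x * B)ᴴ * (P.krausB h x * B)).trace) ((Aᴴ * A).trace * (Bᴴ * B).trace) := by
  have := P.hasSum_step h (LinearMap.mk₂ ℂ (fun M N => (Aᴴ * M * A).trace * (Bᴴ * N * B).trace)
    (fun M M' N => by simp [Matrix.mul_add, Matrix.add_mul, add_mul])
    (fun c M N => by simp [mul_assoc])
    (fun M N N' => by simp [Matrix.mul_add, Matrix.add_mul, mul_add])
    (fun c M N => by simp [mul_left_comm]))
  simp only [LinearMap.mk₂_apply, Matrix.mul_one] at this
  simpa only [conjTranspose_mul, Matrix.mul_assoc] using this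

theorem enorm_div_le {z w : ℂ} (h : ‖z‖ / 120 ≤ ‖w‖) : ‖z‖ₑ / 120 ≤ ‖w‖ₑ := by
  rw [← ofReal_norm, ← ofReal_norm, ← ENNReal.ofReal_ofNat 120,
    ← ENNReal.ofReal_div_of_pos (by norm_num)]
  exact ENNReal.ofReal_le_ofReal h

/-- At a leaf one of the two states of tile 0 is guessed wrongly, and balance gives both a
substantial norm. -/
theorem trace_le_loss_of_balanced (hE : Pairwise (Function.onFun Disjoint E)) (hK : 1 ≤ K)
    (t : ℕ) : ∀ (h : List ℕ)
    (A : Matrix (Fin (P.dimA h)) (Fin 3) ℂ) (B : Matrix (Fin (P.dimB h)) (Fin 3) ℂ),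
    Balanced (Aᴴ * A) → Balanced (Bᴴ * B) →
    ‖(Aᴴ * A).trace * (Bᴴ * B).trace‖ₑ / 120 ≤ P.loss E K t h A B := by
  have hK0 : K ≠ 0 := (zero_lt_one.trans_le hK).ne'
  induction t with
  | zero =>
    intro h A B hA hB
    obtain ⟨s, hs⟩ : ∃ s, h ∉ E (0, s) := by
      by_contra! hc
      exact Set.disjoint_left.1 (hE (show ((0, true) : Fin 4 × Bool) ≠ (0, false) by simp))
        (hc true) (hc false)
    refine le_trans ?_ (P.term_le_loss E K 0 h A B (0, s))
    rw [P.probFrom_zero_of_mem (F := (E (0, s))ᶜ) hs]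
    refine le_trans ?_ le_self_add
    refine le_trans ?_ (le_mul_of_one_le_left zero_le (by exact_mod_cast hK))
    have h1 := hA.le_norm_overlap_self (posSemidef_conjTranspose_mul_self A)
      (posSemidef_conjTranspose_mul_self B) hB s
    rw [← norm_mul] at h1
    refine (enorm_div_le h1).trans ?_
    rw [← trace_eq_overlap]
    exact (enorm_trace_le _ _).trans_eq (by simp only [normSq, sq])
  | succ t ih =>
    intro h A B hA hB
    rw [← (P.hasSum_trace_gram h A B).tsum_eq, loss_succ]
    refine (ENNReal.div_le_div_right enorm_tsum_le_tsum_enorm _).trans ?_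
    rw [ENNReal.div_eq_inv_mul, ← ENNReal.tsum_mul_left]
    refine ENNReal.tsum_le_tsum fun x => ?_
    rw [← ENNReal.div_eq_inv_mul]
    set A' := P.krausA h x * A with hA'
    set B' := P.krausB h x * B with hB'
    -- Small overlaps keep the branch balanced, since the effect of the non-measuring party is
    -- unchanged by its isometry; a large overlap bounds the loss of the branch at once.
    by_cases ho : ∀ i j, i ≠ j → ‖overlap (A'ᴴ * A') (B'ᴴ * B') i j‖ <
        ‖(A'ᴴ * A').trace‖ * ‖(B'ᴴ * B').trace‖ / 120
    · have pA := posSemidef_conjTranspose_mul_self A'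
      have pB := posSemidef_conjTranspose_mul_self B'
      rcases P.step h with ⟨-, hi⟩ | ⟨-, hi⟩
      · have hB'' : Balanced (B'ᴴ * B') := by
          rwa [hB', conjTranspose_mul, Matrix.mul_assoc, ← Matrix.mul_assoc _ _ B, hi,
            Matrix.one_mul]
        exact ih _ _ _ (hB''.left_of_overlap pA pB ho) hB''
      · have hA'' : Balanced (A'ᴴ * A') := by
          rwa [hA', conjTranspose_mul, Matrix.mul_assoc, ← Matrix.mul_assoc _ _ A, hi,
            Matrix.one_mul]
        exact ih _ _ _ hA'' (hA''.right_of_overlap pA pB ho)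
    · push Not at ho
      obtain ⟨i, j, hij, ho⟩ := ho
      rw [← norm_mul] at ho
      refine (enorm_div_le ho).trans ?_
      rw [← trace_eq_overlap]
      exact P.overlap_le_loss hE hK0 hij t _ _ _

theorem balanced_one : Balanced 1 := by
  constructor
  · intro i j hij
    rw [one_apply_ne hij, norm_zero]
    positivity
  · intro i j
    rw [one_apply_eq, one_apply_eq, sub_self, norm_zero]
    positivity

/-- No LOCC protocol discriminates the eight domino states, even asymptotically. -/
theorem not_tendsto_domino (hE : Pairwise (Function.onFun Disjoint E))
    {X : Matrix α (Fin 3) ℂ} {Y : Matrix β (Fin 3) ℂ} (hX : Xᴴ * X = 1) (hY : Yᴴ * Y = 1) :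
    ¬ ∀ i, Filter.Tendsto (fun t => P.prob (E i)ᶜ t (X * domino i * Yᵀ)) Filter.atTop (𝓝 0) := by
  intro ht
  have gX : (P.initA * X)ᴴ * (P.initA * X) = 1 := by
    rw [conjTranspose_mul, Matrix.mul_assoc, ← Matrix.mul_assoc _ _ X, P.initA_isometry,
      Matrix.one_mul, hX]
  have gY : (P.initB * Y)ᴴ * (P.initB * Y) = 1 := by
    rw [conjTranspose_mul, Matrix.mul_assoc, ← Matrix.mul_assoc _ _ Y, P.initB_isometry,
      Matrix.one_mul, hY]
  have hstate : ∀ i, P.initA * (X * domino i * Yᵀ) * P.initBᵀ =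
      P.initA * X * domino i * (P.initB * Y)ᵀ := fun i => by
    simp only [transpose_mul, Matrix.mul_assoc]
  have hnorm : ∀ i, normSq (P.initA * X * domino i * (P.initB * Y)ᵀ) = 2 := by
    intro i
    rw [normSq_eq_ofReal, trace_eq_overlap, gX, gY, overlap_one_self]
    simp
  -- With `K = 1000` the limit is 8 · 2/1000, below 9/120.
  have hlim : Filter.Tendsto (fun t => P.loss E 1000 t [] (P.initA * X) (P.initB * Y))
      Filter.atTop (𝓝 (∑ _i : Fin 4 × Bool,
        (((1000 : NNReal) : ℝ≥0∞) * 0 + ((1000 : NNReal) : ℝ≥0∞)⁻¹ * 2))) := by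
    refine tendsto_finsetSum _ fun i _ => ?_
    simp only [probFrom_univ, hnorm]
    refine Filter.Tendsto.add ?_ tendsto_const_nhds
    refine ENNReal.Tendsto.const_mul ?_ (Or.inr ENNReal.coe_ne_top)
    simpa only [prob, hstate] using ht i
  have hle := ge_of_tendsto' hlim fun t => P.trace_le_loss_of_balanced (E := E) (K := 1000) hE
    (by norm_num) t [] _ _ (gX ▸ balanced_one) (gY ▸ balanced_one)
  rw [gX, gY] at hle
  have h9 : ‖(1 : Matrix (Fin 3) (Fin 3) ℂ).trace * (1 : Matrix (Fin 3) (Fin 3) ℂ).trace‖ₑ =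
      ENNReal.ofReal 9 := by
    rw [← ofReal_norm]
    norm_num
  rw [h9] at hle
  have hfin : (∑ _i : Fin 4 × Bool,
      (((1000 : NNReal) : ℝ≥0∞) * 0 + ((1000 : NNReal) : ℝ≥0∞)⁻¹ * 2)) ≠ ∞ := by
    simp [ENNReal.mul_eq_top]
  have := ENNReal.toReal_mono hfin hle
  norm_num [ENNReal.toReal_mul, ENNReal.toReal_div] at this

end Protocol

/-! ### Families that contain a copy of the domino states -/

variable {α β : Type} [Fintype α] [Fintype β] [DecidableEq α] [DecidableEq β]

/-- Only the modulus of `c` matters, so signs may be absorbed in it; 1/√2 normalizes domino states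
of squared norm 2. -/
theorem not_perfectlyDiscriminable_of_isometry {κ : Type*} {ψ : κ → Matrix α β ℂ}
    {X : Matrix α (Fin 3) ℂ} {Y : Matrix β (Fin 3) ℂ} (hX : Xᴴ * X = 1) (hY : Yᴴ * Y = 1)
    (h : ∀ i, ∃ k, ∃ c : ℂ, ‖c‖ = 1 / √2 ∧ ψ k = c • (X * domino i * Yᵀ)) :
    ¬ PerfectlyDiscriminable ψ := by
  rintro ⟨P, guess, hP⟩
  choose f c hc hψ using h
  have hc2 : ∀ i, ‖c i‖ₑ ^ 2 = 2⁻¹ := fun i => by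
    rw [← ofReal_norm, hc, ← ENNReal.ofReal_pow (by positivity), div_pow, one_pow,
      Real.sq_sqrt (by norm_num), one_div, ENNReal.ofReal_inv_of_pos (by norm_num),
      ENNReal.ofReal_ofNat]
  have hc0 : ∀ i, c i ≠ 0 := fun i h0 => by
    have := hc i
    rw [h0, norm_zero] at this
    exact (by positivity : (1 / √2 : ℝ) ≠ 0) this.symm
  have htr : ∀ i j, ((X * domino i * Yᵀ)ᴴ * (X * domino j * Yᵀ)).trace = overlap 1 1 i j :=
    fun i j => by rw [Protocol.trace_eq_overlap, hX, hY]
  -- Distinct domino states are orthogonal and nonzero, so they sit at different labels; this makes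
  -- the guess sets disjoint.
  have hinj : Function.Injective f := by
    intro i j hij
    by_contra hne
    have h1 : c i • (X * domino i * Yᵀ) = c j • (X * domino j * Yᵀ) := by
      rw [← hψ, ← hψ, hij]
    have h2 := congrArg (fun M => ((X * domino i * Yᵀ)ᴴ * M).trace) h1
    simp only [Matrix.mul_smul, trace_smul, htr, overlap_one_self, overlap_one_eq_zero hne,
      smul_eq_mul, mul_zero] at h2
    exact mul_ne_zero (hc0 i) two_ne_zero h2
  refine P.not_tendsto_domino (E := fun i => {h | guess h = some (f i)}) ?_ hX hY fun i => ?_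
  · intro i j hij
    refine Set.disjoint_left.2 fun h hi hj => hij (hinj ?_)
    simpa using (hi : guess h = _).symm.trans hj
  · have hadd : ∀ t, P.prob {h | guess h = some (f i)} t (ψ (f i)) +
        P.prob {h | guess h = some (f i)}ᶜ t (ψ (f i)) = 1 := by
      intro t
      rw [Protocol.prob, Protocol.prob, P.probFrom_add_compl, hψ]
      have e : P.initA * (c i • (X * domino i * Yᵀ)) * P.initBᵀ =
          c i • (P.initA * (X * domino i * Yᵀ) * P.initBᵀ) := by simp
      rw [e, normSq_smul, hc2, normSq_eq_ofReal, trace_conjTranspose_mul_sandwich,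
        P.initA_isometry, P.initB_isometry, transpose_one, Matrix.mul_one, Matrix.mul_one, htr,
        overlap_one_self]
      simp [ENNReal.inv_mul_cancel]
    have hcompl : ∀ t, P.prob {h | guess h = some (f i)}ᶜ t (X * domino i * Yᵀ) =
        2 * (1 - P.prob {h | guess h = some (f i)} t (ψ (f i))) := by
      intro t
      have hle : P.prob {h | guess h = some (f i)} t (ψ (f i)) ≠ ∞ :=
        ((le_self_add.trans_eq (hadd t)).trans_lt ENNReal.one_lt_top).ne
      have e : P.initA * (c i • (X * domino i * Yᵀ)) * P.initBᵀ =
          c i • (P.initA * (X * domino i * Yᵀ) * P.initBᵀ) := by simp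
      rw [← hadd t, ENNReal.add_sub_cancel_left hle, Protocol.prob, Protocol.prob, hψ, e,
        P.probFrom_smul, hc2, ← mul_assoc, ENNReal.mul_inv_cancel (by simp) (by simp), one_mul]
    simp only [hcompl]
    have hsub := ENNReal.Tendsto.sub (tendsto_const_nhds (x := (1 : ℝ≥0∞))) (hP (f i))
      (Or.inl ENNReal.one_ne_top)
    have := ENNReal.Tendsto.const_mul (a := 2) hsub (Or.inr (by simp))
    simpa using this

theorem not_perfectlyDiscriminable_of_orthonormal {κ : Type*} {ψ : κ → Matrix α β ℂ}
    {x : Fin 3 → α → ℂ} {y : Fin 3 → β → ℂ}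
    (hx : ∀ k l, star (x k) ⬝ᵥ x l = if k = l then 1 else 0)
    (hy : ∀ k l, star (y k) ⬝ᵥ y l = if k = l then 1 else 0)
    (h₀ : ∀ s, ∃ k, ∃ c : ℂ, ‖c‖ = 1 / √2 ∧ ψ k = c • vecMulVec (x 0 + sgn s • x 1) (y 2))
    (h₁ : ∀ s, ∃ k, ∃ c : ℂ, ‖c‖ = 1 / √2 ∧ ψ k = c • vecMulVec (x 2) (y 1 + sgn s • y 2))
    (h₂ : ∀ s, ∃ k, ∃ c : ℂ, ‖c‖ = 1 / √2 ∧ ψ k = c • vecMulVec (x 1 + sgn s • x 2) (y 0))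
    (h₃ : ∀ s, ∃ k, ∃ c : ℂ, ‖c‖ = 1 / √2 ∧ ψ k = c • vecMulVec (x 0) (y 0 + sgn s • y 1)) :
    ¬ PerfectlyDiscriminable ψ := by
  have iso : ∀ {γ : Type} [Fintype γ] (z : Fin 3 → γ → ℂ),
      (∀ k l, star (z k) ⬝ᵥ z l = if k = l then 1 else 0) →
      ((of z)ᵀ)ᴴ * (of z)ᵀ = 1 := by
    intro γ _ z hz
    ext k l
    rw [one_apply, ← hz k l]
    rfl
  refine not_perfectlyDiscriminable_of_isometry (iso x hx) (iso y hy) fun i => ?_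
  have e : (of x)ᵀ * domino i * ((of y)ᵀ)ᵀ =
      vecMulVec ((of x)ᵀ *ᵥ dominoL i) ((of y)ᵀ *ᵥ dominoR i) := by
    rw [domino, mul_vecMulVec, vecMulVec_mul, vecMul_transpose]
  have hv : ∀ {γ : Type} (z : Fin 3 → γ → ℂ) (w : Fin 3 → ℂ),
      (of z)ᵀ *ᵥ w = w 0 • z 0 + w 1 • z 1 + w 2 • z 2 := by
    intro γ z w
    ext a
    simp [mulVec, dotProduct, Fin.sum_univ_three, mul_comm]
  rw [e, hv, hv]
  obtain ⟨k, s⟩ := i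
  fin_cases k
  · simpa [dominoL, dominoR] using h₀ s
  · simpa [dominoL, dominoR] using h₁ s
  · simpa [dominoL, dominoR] using h₂ s
  · simpa [dominoL, dominoR] using h₃ s

/-! ### Cuts of product states -/

/-- The product vector of the parties that satisfy `p`. -/
def part {n : ℕ} {d : Fin n → ℕ} (p : Fin n → Prop) [DecidablePred p]
    (φ : ∀ j, EuclideanSpace ℂ (Fin (d j))) : (∀ j : {j // p j}, Fin (d j)) → ℂ :=
  fun u => ∏ j : {j // p j}, φ j (u j)

section part

variable {n : ℕ} {d : Fin n → ℕ} (φ φ' : ∀ j, EuclideanSpace ℂ (Fin (d j)))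

theorem cut_tensor (S : Finset (Fin n)) :
    cut S (tensor φ) = vecMulVec (part (· ∈ S) φ) (part (· ∉ S) φ) := by
  ext u v
  simp only [cut, tensor, part, vecMulVec_apply]
  rw [← Fintype.prod_subtype_mul_prod_subtype (· ∈ S)]
  congr 1
  · refine Finset.prod_congr rfl fun j _ => ?_
    simp [Equiv.piEquivPiSubtypeProd, j.2]
  · refine Finset.prod_congr rfl fun j _ => ?_
    simp [Equiv.piEquivPiSubtypeProd, j.2]

variable (p : Fin n → Prop) [DecidablePred p]

theorem star_part_dotProduct_part :
    star (part p φ) ⬝ᵥ part p φ' = ∏ j : {j // p j}, inner ℂ (φ j) (φ' j) := by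
  simp only [PiLp.inner_apply, Finset.prod_univ_sum, Fintype.piFinset_univ]
  simp [dotProduct, part, ← Finset.prod_mul_distrib, mul_comm]

theorem inner_tensor : inner ℂ (tensor φ) (tensor φ') = ∏ j, inner ℂ (φ j) (φ' j) := by
  simp only [PiLp.inner_apply, Finset.prod_univ_sum, Fintype.piFinset_univ]
  simp [tensor, ← Finset.prod_mul_distrib]

variable {φ p}

theorem part_update_of_not {j : Fin n} (hj : ¬ p j) (a : EuclideanSpace ℂ (Fin (d j))) :
    part p (Function.update φ j a) = part p φ := by
  ext u
  refine Finset.prod_congr rfl fun i _ => ?_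
  rw [Function.update_of_ne]
  rintro rfl
  exact hj i.2

theorem part_update {j : Fin n} (hj : p j) (a : EuclideanSpace ℂ (Fin (d j)))
    (u : ∀ j : {j // p j}, Fin (d j)) :
    part p (Function.update φ j a) u =
      a (u ⟨j, hj⟩) * ∏ i ∈ Finset.univ.erase (⟨j, hj⟩ : {j // p j}), φ i (u i) := by
  rw [part, ← Finset.mul_prod_erase _ _ (Finset.mem_univ (⟨j, hj⟩ : {j // p j}))]
  simp only [Function.update_self]
  congr 1
  refine Finset.prod_congr rfl fun i hi => ?_
  rw [Function.update_of_ne]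
  exact fun h => (Finset.mem_erase.1 hi).1 (Subtype.ext h)

theorem part_update_pm {j : Fin n} (hj : p j) (s : ℂ) (a b : EuclideanSpace ℂ (Fin (d j))) :
    part p (Function.update φ j (pm s a b)) = ((1 / √2 : ℝ) : ℂ) •
      (part p (Function.update φ j a) + s • part p (Function.update φ j b)) := by
  ext u
  simp only [part_update hj, pm, Pi.smul_apply, Pi.add_apply, PiLp.smul_apply, PiLp.add_apply,
    smul_eq_mul]
  ring

theorem star_part_update_dotProduct {j : Fin n} (hj : p j) (hφ : ∀ j, ‖φ j‖ = 1)
    (a b : EuclideanSpace ℂ (Fin (d j))) :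
    star (part p (Function.update φ j a)) ⬝ᵥ part p (Function.update φ j b) = inner ℂ a b := by
  rw [star_part_dotProduct_part, Fintype.prod_eq_single ⟨j, hj⟩]
  · simp
  · intro i hi
    have hne : (i : Fin n) ≠ j := fun h => hi (Subtype.ext h)
    rw [Function.update_of_ne hne, Function.update_of_ne hne, inner_self_eq_norm_sq_to_K, hφ]
    simp

theorem cut_tensor_update {S : Finset (Fin n)} {j j' : Fin n} (hj : j ∈ S) (hj' : j' ∉ S)
    (a : EuclideanSpace ℂ (Fin (d j))) (b : EuclideanSpace ℂ (Fin (d j'))) :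
    cut S (tensor (Function.update (Function.update φ j a) j' b)) =
      vecMulVec (part (· ∈ S) (Function.update φ j a))
        (part (· ∉ S) (Function.update φ j' b)) := by
  have hne : j ≠ j' := fun h => hj' (h ▸ hj)
  rw [cut_tensor, part_update_of_not hj', Function.update_comm hne,
    part_update_of_not (p := (· ∉ S)) (not_not.2 hj)]

end part

/-- A set of product states that contains the domino states of the parties `j` and `j'` cannot be
discriminated when these two parties are separated. -/
theorem not_perfectlyDiscriminable_cut {n : ℕ} {d : Fin n → ℕ}
    {φ : ∀ j, EuclideanSpace ℂ (Fin (d j))} (hφ : ∀ j, ‖φ j‖ = 1) {j j' : Fin n} (hne : j ≠ j')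
    {e : Fin 3 → EuclideanSpace ℂ (Fin (d j))} {g : Fin 3 → EuclideanSpace ℂ (Fin (d j'))}
    (he : Orthonormal ℂ e) (hg : Orthonormal ℂ g) {G : Set (Space d)}
    (h₀ : ∀ s, tensor (Function.update (Function.update φ j (pm (sgn s) (e 0) (e 1))) j' (g 2)) ∈ G)
    (h₁ : ∀ s, tensor (Function.update (Function.update φ j (e 2)) j' (pm (sgn s) (g 1) (g 2))) ∈ G)
    (h₂ : ∀ s, tensor (Function.update (Function.update φ j (pm (sgn s) (e 1) (e 2))) j' (g 0)) ∈ G)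
    (h₃ : ∀ s, tensor (Function.update (Function.update φ j (e 0)) j' (pm (sgn s) (g 0) (g 1))) ∈ G)
    {S : Finset (Fin n)} (hS : ¬ (j ∈ S ↔ j' ∈ S)) :
    ¬ PerfectlyDiscriminable (fun ψ : G => cut S (ψ : Space d)) := by
  have hc : ‖((1 / √2 : ℝ) : ℂ)‖ = 1 / √2 := Complex.norm_of_nonneg (by positivity)
  have hc' : ∀ s, ‖sgn s * ((1 / √2 : ℝ) : ℂ)‖ = 1 / √2 := fun s => by
    rw [norm_mul, hc]; cases s <;> simp [sgn]
  have hs : ∀ s, sgn s * sgn s = 1 := fun s => by cases s <;> simp [sgn]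
  by_cases hj : j ∈ S
  · have hj' : j' ∉ S := fun h => hS ⟨fun _ => h, fun _ => hj⟩
    refine not_perfectlyDiscriminable_of_orthonormal
      (x := fun k => part (· ∈ S) (Function.update φ j (e k)))
      (y := fun k => part (· ∉ S) (Function.update φ j' (g k)))
      (fun k l => ?_) (fun k l => ?_) (fun s => ⟨⟨_, h₀ s⟩, _, hc, ?_⟩)
      (fun s => ⟨⟨_, h₁ s⟩, _, hc, ?_⟩) (fun s => ⟨⟨_, h₂ s⟩, _, hc, ?_⟩)
      (fun s => ⟨⟨_, h₃ s⟩, _, hc, ?_⟩)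
    · convert (star_part_update_dotProduct (p := (· ∈ S)) hj hφ (e k) (e l)).trans
        (orthonormal_iff_ite.1 he k l)
    · rw [star_part_update_dotProduct (p := (· ∉ S)) hj' hφ, orthonormal_iff_ite.1 hg]
    all_goals
      simp only [cut_tensor_update hj hj', part_update_pm (p := (· ∈ S)) hj,
        part_update_pm (p := (· ∉ S)) hj', smul_vecMulVec, vecMulVec_smul]
  · have hj' : j' ∈ S := by_contra fun h => hS ⟨fun h' => absurd h' hj, fun h' => absurd h' h⟩
    have hrev : ∀ s (u v : (∀ j : {j // j ∉ S}, Fin (d j)) → ℂ),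
        u + sgn s • v = sgn s • (v + sgn s • u) := fun s u v => by
      rw [smul_add, smul_smul, hs, one_smul, add_comm]
    -- Exchanging the parties and reversing one basis permutes the domino states up to sign: `h₃`,
    -- `h₀`, `h₁`, `h₂` take the four roles, and `hrev` supplies the sign.
    refine not_perfectlyDiscriminable_of_orthonormal
      (x := fun k => part (· ∈ S) (Function.update φ j' (g k)))
      (y := fun k => part (· ∉ S) (Function.update φ j (e k.rev)))
      (fun k l => ?_) (fun k l => ?_) (fun s => ⟨⟨_, h₃ s⟩, _, hc, ?_⟩)
      (fun s => ⟨⟨_, h₀ s⟩, _, hc' s, ?_⟩) (fun s => ⟨⟨_, h₁ s⟩, _, hc, ?_⟩)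
      (fun s => ⟨⟨_, h₂ s⟩, _, hc' s, ?_⟩)
    · convert (star_part_update_dotProduct (p := (· ∈ S)) hj' hφ (g k) (g l)).trans
        (orthonormal_iff_ite.1 hg k l)
    · rw [star_part_update_dotProduct (p := (· ∉ S)) hj hφ, orthonormal_iff_ite.1 he]
      simp
    all_goals
      simp only [Function.update_comm hne, cut_tensor_update hj' hj,
        part_update_pm (p := (· ∈ S)) hj', part_update_pm (p := (· ∉ S)) hj, smul_vecMulVec,
        vecMulVec_smul]
      try rfl
    all_goals
      rw [hrev, vecMulVec_smul, smul_smul, mul_comm]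
      rfl

/-! ### The set `𝔾₃` -/

/-- The family of the three local vectors `a, b, c`. -/
def triple (a : EuclideanSpace ℂ (Fin 4)) (b c : EuclideanSpace ℂ (Fin 3)) :
    ∀ j, EuclideanSpace ℂ (Fin (![4, 3, 3] j)) := fun j => match j with
  | 0 => a
  | 1 => b
  | 2 => c

/-- The vectors `a'` and `b'` are overwritten and hence arbitrary, so one background `triple` serves
all eight states. -/
theorem tri_eq_tensor_update_one (a a' : EuclideanSpace ℂ (Fin 4))
    (b b' c : EuclideanSpace ℂ (Fin 3)) :
    tri a b c = tensor (Function.update (Function.update (triple a' b' c) 0 a) 1 b) := by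
  refine congrArg tensor (funext fun j => ?_)
  fin_cases j <;> rfl

theorem tri_eq_tensor_update_two (a a' : EuclideanSpace ℂ (Fin 4))
    (b c c' : EuclideanSpace ℂ (Fin 3)) :
    tri a b c = tensor (Function.update (Function.update (triple a' b c') 0 a) 2 c) := by
  refine congrArg tensor (funext fun j => ?_)
  fin_cases j <;> rfl

theorem norm_triple {a : EuclideanSpace ℂ (Fin 4)} {b c : EuclideanSpace ℂ (Fin 3)}
    (ha : ‖a‖ = 1) (hb : ‖b‖ = 1) (hc : ‖c‖ = 1) (j : Fin 3) : ‖triple a b c j‖ = 1 := by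
  fin_cases j
  exacts [ha, hb, hc]

theorem inner_tri (a a' : EuclideanSpace ℂ (Fin 4)) (b b' c c' : EuclideanSpace ℂ (Fin 3)) :
    inner ℂ (tri a b c) (tri a' b' c') = inner ℂ a a' * inner ℂ b b' * inner ℂ c c' := by
  rw [tri, tri, inner_tensor, Fin.prod_univ_three]
  rfl

theorem inner_pm_left {m : ℕ} (s : ℂ) (u v w : EuclideanSpace ℂ (Fin m)) :
    inner ℂ (pm s u v) w =
      ((1 / √2 : ℝ) : ℂ) * (inner ℂ u w + starRingEnd ℂ s * inner ℂ v w) := by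
  rw [pm, inner_smul_left, inner_add_left, inner_smul_left, Complex.conj_ofReal]

theorem inner_pm_right {m : ℕ} (s : ℂ) (u v w : EuclideanSpace ℂ (Fin m)) :
    inner ℂ w (pm s u v) = ((1 / √2 : ℝ) : ℂ) * (inner ℂ w u + s * inner ℂ w v) := by
  rw [pm, inner_smul_right, inner_add_right, inner_smul_right]

theorem inner_pm_pm {m : ℕ} {u v : EuclideanSpace ℂ (Fin m)} (hu : inner ℂ u u = (1 : ℂ))
    (hv : inner ℂ v v = (1 : ℂ)) (huv : inner ℂ u v = (0 : ℂ)) (hvu : inner ℂ v u = (0 : ℂ))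
    (s s' : Bool) : inner ℂ (pm (sgn s) u v) (pm (sgn s') u v) = if s = s' then (1 : ℂ) else 0 := by
  have h2 : ((1 / √2 : ℝ) : ℂ) * ((1 / √2 : ℝ) : ℂ) * 2 = 1 := by
    rw [← Complex.ofReal_mul, div_mul_div_comm, Real.mul_self_sqrt (by norm_num)]
    norm_num
  rw [inner_pm_left, inner_pm_right, inner_pm_right, hu, hv, huv, hvu]
  cases s <;> cases s' <;> simp only [sgn] <;> simp
  all_goals
    rw [← h2]
    simp
    ring

/-! ### Orthonormality of the fourteen states -/

section family

variable (pA qA oneA twoA : EuclideanSpace ℂ (Fin 4)) (pB qB oneB : EuclideanSpace ℂ (Fin 3))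
  (pC qC twoC : EuclideanSpace ℂ (Fin 3))

/-- The fourteen states of `𝔾₃` as an indexed family. -/
def G3Family (i : Fin 7 × Bool) : Space ![4, 3, 3] :=
  ![tri (pm (sgn i.2) pA qA) oneB twoC,
    tri oneA (pm (sgn i.2) qB oneB) twoC,
    tri (pm (sgn i.2) qA oneA) pB twoC,
    tri pA (pm (sgn i.2) pB qB) twoC,
    tri twoA oneB (pm (sgn i.2) qC twoC),
    tri (pm (sgn i.2) qA twoA) oneB pC,
    tri pA oneB (pm (sgn i.2) pC qC)] i.1

theorem G3_eq_range : G3 pA qA oneA twoA pB qB oneB pC qC twoC =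
    Set.range (G3Family pA qA oneA twoA pB qB oneB pC qC twoC) := by
  ext ψ
  simp only [G3, Set.mem_iUnion, Set.mem_range, Prod.exists, Bool.exists_bool, Fin.exists_fin_succ]
  simp [G3Family, sgn, eq_comm]
  tauto

variable {pA qA oneA twoA pB qB oneB pC qC twoC}

/-- States of different types have orthogonal factors at some party; within a type only the sign in
one factor varies. -/
theorem orthonormal_G3Family (hA : Orthonormal ℂ ![pA, qA, oneA, twoA])
    (hB : Orthonormal ℂ ![pB, qB, oneB]) (hC : Orthonormal ℂ ![pC, qC, twoC]) :
    Orthonormal ℂ (G3Family pA qA oneA twoA pB qB oneB pC qC twoC) := by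
  rw [orthonormal_iff_ite] at hA hB hC ⊢
  simp [Fin.forall_fin_succ, -inner_self_eq_norm_sq_to_K] at hA hB hC
  obtain ⟨⟨a₀₀, a₀₁, a₀₂, a₀₃⟩, ⟨a₁₀, a₁₁, a₁₂, a₁₃⟩, ⟨a₂₀, a₂₁, a₂₂, a₂₃⟩, a₃₀, a₃₁, a₃₂, a₃₃⟩ := hA
  obtain ⟨⟨b₀₀, b₀₁, b₀₂⟩, ⟨b₁₀, b₁₁, b₁₂⟩, b₂₀, b₂₁, b₂₂⟩ := hB
  obtain ⟨⟨c₀₀, c₀₁, c₀₂⟩, ⟨c₁₀, c₁₁, c₁₂⟩, c₂₀, c₂₁, c₂₂⟩ := hC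
  rintro ⟨k, s⟩ ⟨l, s'⟩
  by_cases hkl : k = l
  · subst hkl
    fin_cases k <;> simp [G3Family, inner_tri, inner_pm_pm, *, -inner_self_eq_norm_sq_to_K]
  · rw [if_neg fun h => hkl (congrArg Prod.fst h)]
    fin_cases k <;> fin_cases l <;>
      first
        | exact absurd rfl hkl
        | simp [G3Family, inner_tri, inner_pm_left, inner_pm_right, *,
            -inner_self_eq_norm_sq_to_K]

end family

end GNPS

end
theorem proposition1
    (pA qA oneA twoA : EuclideanSpace ℂ (Fin 4))
    (pB qB oneB : EuclideanSpace ℂ (Fin 3))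
    (pC qC twoC : EuclideanSpace ℂ (Fin 3))
    (hA : Orthonormal ℂ ![pA, qA, oneA, twoA])
    (hB : Orthonormal ℂ ![pB, qB, oneB])
    (hC : Orthonormal ℂ ![pC, qC, twoC]) :
    GNPS.IsGNPS (GNPS.G3 pA qA oneA twoA pB qB oneB pC qC twoC) := by
  open GNPS in
  have npA : ‖pA‖ = 1 := hA.1 0
  have n1B : ‖oneB‖ = 1 := hB.1 2
  have n2C : ‖twoC‖ = 1 := hC.1 2
  have hsgn : ∀ s, sgn s ∈ ({1, -1} : Set ℂ) := fun s => by cases s <;> simp [sgn]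
  constructor
  · rw [G3_eq_range]
    exact (orthonormal_G3Family hA hB hC).toSubtypeRange
  · intro ψ hψ
    simp only [G3, Set.mem_iUnion] at hψ
    obtain ⟨s, -, hψ⟩ := hψ
    rcases hψ with rfl | rfl | rfl | rfl | rfl | rfl | rfl <;> exact ⟨_, rfl⟩
  · intro S hS hS'
    -- If A were on the same side as both B and C, one side of the cut would be empty.
    have hcases : ¬ ((0 : Fin 3) ∈ S ↔ 1 ∈ S) ∨ ¬ ((0 : Fin 3) ∈ S ↔ 2 ∈ S) := by
      by_contra! hc
      obtain ⟨i, hi⟩ := hS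
      obtain ⟨j, hj⟩ := hS'
      rw [Finset.mem_compl] at hj
      fin_cases i <;> fin_cases j <;> simp_all
    rcases hcases with hc | hc
    · have hA' : Orthonormal ℂ ![pA, qA, oneA] := by
        convert hA.comp ![0, 1, 2] (by decide) using 1
        ext i; fin_cases i <;> rfl
      refine not_perfectlyDiscriminable_cut (φ := triple pA oneB twoC) (norm_triple npA n1B n2C)
        (j := 0) (j' := 1) (by decide) (e := ![pA, qA, oneA]) (g := ![pB, qB, oneB]) hA' hB
        (fun s => Set.mem_biUnion (hsgn s) ?_) (fun s => Set.mem_biUnion (hsgn s) ?_)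
        (fun s => Set.mem_biUnion (hsgn s) ?_) (fun s => Set.mem_biUnion (hsgn s) ?_) hc
      · exact Or.inl (tri_eq_tensor_update_one _ _ _ _ _).symm
      · exact Or.inr <| Or.inl (tri_eq_tensor_update_one _ _ _ _ _).symm
      · exact Or.inr <| Or.inr <| Or.inl (tri_eq_tensor_update_one _ _ _ _ _).symm
      · exact Or.inr <| Or.inr <| Or.inr <| Or.inl (tri_eq_tensor_update_one _ _ _ _ _).symm
    · have hA' : Orthonormal ℂ ![pA, qA, twoA] := by
        convert hA.comp ![0, 1, 3] (by decide) using 1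
        ext i; fin_cases i <;> rfl
      refine not_perfectlyDiscriminable_cut (φ := triple pA oneB twoC) (norm_triple npA n1B n2C)
        (j := 0) (j' := 2) (by decide) (e := ![pA, qA, twoA]) (g := ![pC, qC, twoC]) hA' hC
        (fun s => Set.mem_biUnion (hsgn s) ?_) (fun s => Set.mem_biUnion (hsgn s) ?_)
        (fun s => Set.mem_biUnion (hsgn s) ?_) (fun s => Set.mem_biUnion (hsgn s) ?_) hc
      · exact Or.inl (tri_eq_tensor_update_two _ _ _ _ _).symm
      · exact Or.inr <| Or.inr <| Or.inr <| Or.inr <| Or.inl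
          (tri_eq_tensor_update_two _ _ _ _ _).symm
      · exact Or.inr <| Or.inr <| Or.inr <| Or.inr <| Or.inr <| Or.inl
          (tri_eq_tensor_update_two _ _ _ _ _).symm
      · exact Or.inr <| Or.inr <| Or.inr <| Or.inr <| Or.inr <| Or.inr
          (tri_eq_tensor_update_two _ _ _ _ _).symm
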